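/- Let $M=([n],\mathcal I)$ be a matroid on $n$ elements of rank $r$, let $\mu$ be the uniform probability distribution on the set $\mathcal B$ of bases of $M$, and let $P$ be the transition matrix on $\mathcal B$ of the following (down-up) random walk: from a basis $\tau$, first drop an element $i\in\tau$ chosen uniformly at random, then move to a basis $\sigma\supseteq\tau\setminus\{i\}$ chosen uniformly at random among all such bases (if $r=0$, the walk stays at the only basis $\emptyset$). For a basis $B$ and $\epsilon>0$, let $$t_B(\epsilon)=\min\{t\in\mathbb Z_{\ge 0} : \|P^t(B,\cdot)-\mu\|_1\le\epsilon\}$$ be the total variation mixing time of the walk started at $B$. Then for every basis $B$ of $M$ and every $0<\epsilon<1$, the minimum $t_B(\epsilon)$ exists and (with natural logarithms) $$t_B(\epsilon)\ \le\ r\log(n^r/\epsilon)\ \le\ r^2\log(n/\epsilon),$$ with the exception of the single case in which $n=2$, $r=1$, $M$ has no loops (so that $M$ is the uniform matroid $U_{1,2}$) and $\epsilon>2/e$. (For $r=0$ both bounds are read as $0$, also when $n=0$.) -/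

import Mathlib

noncomputable section

/-- The support `{S ⊆ α | μ S ≠ 0}` of a weight function on the subsets of a finite set. -/
abbrev SetSupport {α : Type*} (μ : Finset α → ℝ) : Type _ :=
  {S : Finset α // μ S ≠ 0}

/-- The transition matrix of the down-up walk with state space the support of `μ`:
from `τ`, drop an element `i ∈ τ` chosen uniformly at random, then move to one of the sets
`σ ⊇ τ \ {i}` of the support, chosen with probability proportional to `μ σ`.
(From `τ = ∅` there is nothing to drop, and the walk stays where it is.) -/
def downUpWalk {α : Type*} [Fintype α] [DecidableEq α] (μ : Finset α → ℝ) :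
    Matrix (SetSupport μ) (SetSupport μ) ℝ :=
  fun τ σ =>
    if τ.1 = ∅ then (if σ = τ then 1 else 0)
    else ∑ i ∈ τ.1, (1 / (τ.1.card : ℝ)) *
      (if τ.1.erase i ⊆ σ.1 then
        μ σ.1 / ∑ ρ : SetSupport μ, (if τ.1.erase i ⊆ ρ.1 then μ ρ.1 else 0)
      else 0)

/-- `t` is the total variation mixing time at accuracy `ε`, from the state `τ`, of the Markov chain
with transition matrix `P` and stationary distribution `π`:
the least `t` such that `‖P ^ t (τ, ·) - π‖₁ ≤ ε`. -/
def IsMixingTime {Ω : Type*} [Fintype Ω] [DecidableEq Ω] (P : Matrix Ω Ω ℝ) (π : Ω → ℝ)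
    (τ : Ω) (ε : ℝ) (t : ℕ) : Prop :=
  IsLeast {s : ℕ | ∑ σ, |(P ^ s) τ σ - π σ| ≤ ε} t

open Classical in
/-- The uniform probability distribution on the bases of a matroid on a finite type. -/
def uniformOnBases {α : Type*} [Fintype α] (M : Matroid α) : Finset α → ℝ :=
  fun S =>
    if M.IsBase (S : Set α) then
      1 / ((Finset.univ.filter fun T : Finset α => M.IsBase (T : Set α)).card : ℝ)
    else 0

theorem uniformOnBases_ne_zero {α : Type*} [Fintype α] {M : Matroid α} {B : Finset α}
    (hB : M.IsBase (B : Set α)) : uniformOnBases M B ≠ 0 := by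
  classical
  unfold uniformOnBases
  rw [if_pos hB]
  have h : 0 < (Finset.univ.filter fun T : Finset α => M.IsBase (T : Set α)).card :=
    Finset.card_pos.mpr ⟨B, by simpa using hB⟩
  have h2 : (0 : ℝ) < 1 / ((Finset.univ.filter
      fun T : Finset α => M.IsBase (T : Set α)).card : ℝ) := by positivity
  convert h2.ne'

end

/-! The walk is reversible with respect to the uniform distribution, and its matrix is positive
semidefinite, a nonnegative combination of the rank-one matrices of the sets `U` of size `r - 1`. So
everything follows from one spectral estimate: on functions of sum zero the quadratic form of the
walk is at most `1 - 1/r` times the squared norm. The `ℓ²` distance to uniform then shrinks by this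
factor at each step, Cauchy–Schwarz gives an `ℓ¹` distance of at most `√N (1 - 1/r)^t` with `N ≤
n^r` bases, and `t = ⌊r log (n^r/ε)⌋` suffices when `r ≥ 2`.

The estimate is a local-to-global argument. For an independent set `S`, weight the pairs `i, j` by
the number of bases containing `S ∪ {i, j}`; the claim is that this matrix has at most one positive
eigenvalue (`LinkLogConcave`). At corank two the graph is complete multipartite, its classes being
the parallel classes of the contraction `M / S` (`quadForm_mul_le_sq_of_multipartite`). At larger
corank the property trickles down from the sets `S ∪ {k}`, because the graph is connected
(`quadForm_mul_le_sq_of_trickle`, `link_connected`). The property at `S` bounds the variance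
explained by conditioning on one more element (`sum_sq_linkSum_div_le`); iterating from `∅` up to
corank one gives the Poincaré inequality `upVar_empty_le_sum`. -/

/-! ### Quadratic forms with at most one positive eigenvalue. -/

open Finset in
/-- One positive eigenvalue for a weighted graph. -/
theorem quadForm_mul_le_sq_of_trickle {ι : Type*} [Fintype ι] [DecidableEq ι]
    (A : ι → ι → ℝ) (D : ι → ℝ) (hsymm : ∀ i j, A i j = A j i) (hnn : ∀ i j, 0 ≤ A i j)
    (hD : ∀ i, ∑ j, A i j = D i)
    (hconn : ∀ h : ι → ℝ, (∀ i j, A i j ≠ 0 → h i = h j) →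
      ∀ i j, D i ≠ 0 → D j ≠ 0 → h i = h j)
    (hq : ∀ g : ι → ℝ, ∑ i, ∑ j, A i j * g i * g j ≤ ∑ k, (∑ j, A k j * g j) ^ 2 / D k)
    (g : ι → ℝ) :
    (∑ i, ∑ j, A i j * g i * g j) * ∑ i, D i ≤ (∑ i, D i * g i) ^ 2 := by
  classical
  have hDnn : ∀ i, 0 ≤ D i := fun i => by rw [← hD]; exact sum_nonneg fun j _ => hnn i j
  have hA0 : ∀ i j, D i = 0 → A i j = 0 := fun i j h => by
    rw [← hD] at h
    exact (sum_eq_zero_iff_of_nonneg fun j _ => hnn i j).1 h j (mem_univ j)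
  have hsq : ∀ i, √(D i) * √(D i) = D i := fun i => Real.mul_self_sqrt (hDnn i)
  have hs0 : ∀ i, √(D i) = 0 ↔ D i = 0 := fun i => Real.sqrt_eq_zero (hDnn i)
  -- The normalized adjacency matrix. Where `D` vanishes, so does the row of `A`, and division by
  -- zero gives the right entry `0`.
  let S : Matrix ι ι ℝ := Matrix.of fun i j => A i j / (√(D i) * √(D j))
  have hSA : ∀ i j, √(D i) * S i j * √(D j) = A i j := by
    intro i j
    by_cases hi : D i = 0
    · simp [S, hA0 i j hi]
    by_cases hj : D j = 0
    · simp [S, hsymm i j, hA0 j i hj]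
    have := mt (hs0 i).1 hi
    have := mt (hs0 j).1 hj
    simp only [S, Matrix.of_apply]
    field_simp
  have hS : S.IsHermitian := by
    ext i j
    simp [S, hsymm i j, mul_comm]
  let u : EuclideanSpace ℝ ι := WithLp.toLp 2 fun i => √(D i)
  let x : EuclideanSpace ℝ ι := WithLp.toLp 2 fun i => √(D i) * g i
  -- A positive eigenvalue must be `1`, with eigenvector proportional to `u = √D`; then equality
  -- holds here. Summing over the eigenbasis with Parseval for `u` gives the claim without
  -- discussing multiplicities.
  have key : ∀ k, (∀ y : EuclideanSpace ℝ ι,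
      hS.eigenvalues k * (inner ℝ (hS.eigenvectorBasis k) y) ^ 2 * (inner ℝ u u) ^ 2 ≤
        (inner ℝ (hS.eigenvectorBasis k) u) ^ 2 * (inner ℝ u y) ^ 2) := by
    intro k y
    set v := hS.eigenvectorBasis k with hv
    set l := hS.eigenvalues k with hl
    rcases le_or_gt l 0 with hl0 | hl0
    · have : l * (inner ℝ v y) ^ 2 * (inner ℝ u u) ^ 2 ≤ 0 := by
        apply mul_nonpos_of_nonpos_of_nonneg _ (sq_nonneg _)
        exact mul_nonpos_of_nonpos_of_nonneg hl0 (sq_nonneg _)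
      exact this.trans (by positivity)
    have hev : ∀ i, ∑ j, S i j * v j = l * v i := by
      intro i
      have := congrFun (hS.mulVec_eigenvectorBasis k) i
      simpa [Matrix.mulVec, dotProduct] using this
    have hv0 : ∀ i, D i = 0 → v i = 0 := by
      intro i hi
      have h1 := hev i
      have : ∑ j, S i j * v j = 0 := sum_eq_zero fun j _ => by simp [S, hA0 i j hi]
      rw [this] at h1
      exact (mul_eq_zero.1 h1.symm).resolve_left hl0.ne'
    let w : ι → ℝ := fun i => v i / √(D i)
    have hvw : ∀ i, v i = √(D i) * w i := by
      intro i
      by_cases hi : D i = 0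
      · simp [hv0 i hi, w]
      · have := mt (hs0 i).1 hi
        simp only [w]; field_simp
    have hAw : ∀ i, ∑ j, A i j * w j = l * (D i * w i) := by
      intro i
      calc ∑ j, A i j * w j = ∑ j, √(D i) * (S i j * v j) := by
            refine sum_congr rfl fun j _ => ?_
            rw [← hSA, hvw j]; ring
        _ = √(D i) * (l * v i) := by rw [← mul_sum, hev]
        _ = l * ((√(D i) * √(D i)) * w i) := by rw [hvw i]; ring
        _ = _ := by rw [hsq]
    have hquad : ∑ i, ∑ j, A i j * w i * w j = l * ∑ i, D i * w i ^ 2 := by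
      calc _ = ∑ i, w i * ∑ j, A i j * w j := by
            refine sum_congr rfl fun i _ => ?_
            rw [mul_sum]; exact sum_congr rfl fun j _ => by ring
        _ = _ := by
            rw [mul_sum]; refine sum_congr rfl fun i _ => ?_
            rw [hAw]; ring
    have hE : 0 < ∑ i, D i * w i ^ 2 := by
      have h1 : ∑ i, D i * w i ^ 2 = inner ℝ v v := by
        simp only [PiLp.inner_apply, RCLike.inner_apply, conj_trivial]
        refine sum_congr rfl fun i _ => ?_
        rw [hvw i]
        linear_combination (-w i ^ 2) * hsq i
      rw [h1, real_inner_self_eq_norm_sq, hv, hS.eigenvectorBasis.orthonormal.1 k]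
      norm_num
    -- On an eigenvector `hq` reads `l ≤ l ^ 2`. The Dirichlet form below gives `l ≤ 1` in return,
    -- and at `l = 1` it vanishes, so `w` is constant along edges.
    have hl1 : 1 ≤ l := by
      have h1 := hq w
      rw [hquad] at h1
      have h2 : ∑ k, (∑ j, A k j * w j) ^ 2 / D k = l ^ 2 * ∑ i, D i * w i ^ 2 := by
        rw [mul_sum]; refine sum_congr rfl fun i _ => ?_
        rw [hAw]
        by_cases hi : D i = 0
        · simp [hi]
        · field_simp
      rw [h2] at h1
      have h3 : l ≤ l ^ 2 := le_of_mul_le_mul_right h1 hE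
      nlinarith
    have hdir : ∑ i, ∑ j, A i j * (w i - w j) ^ 2 = 2 * (1 - l) * ∑ i, D i * w i ^ 2 := by
      have h1 : ∑ i, ∑ j, A i j * w i ^ 2 = ∑ i, D i * w i ^ 2 :=
        sum_congr rfl fun i _ => by rw [← sum_mul, hD]
      have h2 : ∑ i, ∑ j, A i j * w j ^ 2 = ∑ i, D i * w i ^ 2 := by
        rw [sum_comm, ← h1]
        exact sum_congr rfl fun i _ => sum_congr rfl fun j _ => by rw [hsymm]
      calc _ = ∑ i, ∑ j, A i j * w i ^ 2 + ∑ i, ∑ j, A i j * w j ^ 2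
            - 2 * ∑ i, ∑ j, A i j * w i * w j := by
            rw [mul_sum, ← sum_add_distrib, ← sum_sub_distrib]
            refine sum_congr rfl fun i _ => ?_
            rw [mul_sum, ← sum_add_distrib, ← sum_sub_distrib]
            exact sum_congr rfl fun j _ => by ring
        _ = _ := by rw [h1, h2, hquad]; ring
    have hterm : ∀ i j, 0 ≤ A i j * (w i - w j) ^ 2 := fun i j =>
      mul_nonneg (hnn i j) (sq_nonneg _)
    have hdnn : 0 ≤ ∑ i, ∑ j, A i j * (w i - w j) ^ 2 :=
      sum_nonneg fun i _ => sum_nonneg fun j _ => hterm i j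
    have hleq : l = 1 := by
      rw [hdir] at hdnn
      nlinarith
    have hd0 : ∑ i, ∑ j, A i j * (w i - w j) ^ 2 = 0 := by rw [hdir, hleq]; ring
    have hwc : ∀ i j, A i j ≠ 0 → w i = w j := by
      intro i j hij
      have h1 := (sum_eq_zero_iff_of_nonneg
        (fun i _ => sum_nonneg fun j _ => hterm i j)).1 hd0 i (mem_univ i)
      have h2 := (sum_eq_zero_iff_of_nonneg (fun j _ => hterm i j)).1 h1 j (mem_univ j)
      have h3 := (mul_eq_zero.1 h2).resolve_left hij
      exact sub_eq_zero.1 (pow_eq_zero_iff (two_ne_zero) |>.1 h3)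
    have hcon := hconn w hwc
    obtain ⟨c, hc⟩ : ∃ c, v = c • u := by
      by_cases hex : ∃ i, D i ≠ 0
      · obtain ⟨i, hi⟩ := hex
        refine ⟨w i, ?_⟩
        ext j
        by_cases hj : D j = 0
        · simp [u, hv0 j hj, hj]
        · rw [hvw j, hcon j i hj hi]; simp [u, mul_comm]
      · push Not at hex
        exact ⟨0, by ext j; simp [hv0 j (hex j)]⟩
    rw [hc, hleq]
    simp only [real_inner_smul_left]
    apply le_of_eq; ring
  have huu : inner ℝ u u = ∑ i, D i := by
    simp only [PiLp.inner_apply, RCLike.inner_apply, conj_trivial, u, hsq]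
  have hux : inner ℝ u x = ∑ i, D i * g i := by
    simp only [PiLp.inner_apply, RCLike.inner_apply, conj_trivial, u, x]
    refine sum_congr rfl fun i _ => ?_
    linear_combination g i * hsq i
  have hxx : ∑ i, ∑ j, A i j * g i * g j =
      ∑ k, hS.eigenvalues k * (inner ℝ (hS.eigenvectorBasis k) x) ^ 2 := by
    let y : EuclideanSpace ℝ ι := WithLp.toLp 2 (S.mulVec x.ofLp)
    have h1 : ∑ i, ∑ j, A i j * g i * g j = inner ℝ x y := by
      simp only [PiLp.inner_apply, RCLike.inner_apply, conj_trivial, y, x, Matrix.mulVec,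
        dotProduct]
      refine sum_congr rfl fun i _ => ?_
      rw [sum_mul]
      refine sum_congr rfl fun j _ => ?_
      rw [← hSA]; ring
    rw [h1, ← hS.eigenvectorBasis.sum_inner_mul_inner x y]
    refine sum_congr rfl fun k _ => ?_
    have h2 : inner ℝ (hS.eigenvectorBasis k) y =
        hS.eigenvalues k * inner ℝ (hS.eigenvectorBasis k) x := by
      have hev : ∀ i, ∑ j, S i j * hS.eigenvectorBasis k j =
          hS.eigenvalues k * hS.eigenvectorBasis k i := by
        intro i
        have := congrFun (hS.mulVec_eigenvectorBasis k) i
        simpa [Matrix.mulVec, dotProduct] using this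
      simp only [PiLp.inner_apply, RCLike.inner_apply, conj_trivial, y, Matrix.mulVec,
        dotProduct, sum_mul, mul_sum]
      rw [sum_comm]
      refine sum_congr rfl fun j _ => ?_
      calc _ = (∑ i, S j i * hS.eigenvectorBasis k i) * x j := by
            rw [sum_mul]; refine sum_congr rfl fun i _ => ?_
            have : S i j = S j i := by simpa using hS.apply j i
            rw [this]; ring
        _ = _ := by rw [hev]; ring
    rw [h2, real_inner_comm]; ring
  have hpars : ∑ k, (inner ℝ (hS.eigenvectorBasis k) u) ^ 2 = inner ℝ u u := by
    rw [← hS.eigenvectorBasis.sum_inner_mul_inner u u]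
    refine sum_congr rfl fun k _ => ?_
    rw [real_inner_comm]; ring
  have hfin := sum_le_sum fun k (_ : k ∈ univ) => key k x
  rw [← sum_mul, ← sum_mul, ← hxx, hpars, hux, huu] at hfin
  rcases (sum_nonneg fun i (_ : i ∈ univ) => hDnn i).eq_or_lt with h0 | h0
  · rw [← h0, mul_zero]; positivity
  · refine le_of_mul_le_mul_right ?_ h0
    linarith

open Finset in
/-- One positive eigenvalue for a complete multipartite graph. -/
theorem quadForm_mul_le_sq_of_multipartite {ι κ : Type*} [Fintype ι] [DecidableEq κ]
    (A : ι → ι → ℝ) (e : ι → ℝ) (C : ι → κ)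
    (hA : ∀ i j, A i j = e i * e j * (1 - if C i = C j then 1 else 0))
    (he : ∀ i, 0 ≤ e i) (g : ι → ℝ) :
    (∑ i, ∑ j, A i j * g i * g j) * (∑ i, ∑ j, A i j) ≤ (∑ i, ∑ j, A i j * g i) ^ 2 := by
  classical
  set a := ∑ i, e i * g i with ha
  set b := ∑ i, e i with hb
  rcases (sum_nonneg fun i (_ : i ∈ univ) => he i).eq_or_lt with h0 | h0
  · have h1 : ∀ i, e i = 0 := fun i =>
      (sum_eq_zero_iff_of_nonneg fun i _ => he i).1 h0.symm i (mem_univ i)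
    simp [hA, h1]
  have hsymm : ∀ i j, A i j = A j i := fun i j => by
    rw [hA, hA]; simp only [eq_comm (a := C i)]; ring
  -- The form is the square of `∑ e h` minus the squares of the same sum over each class.
  have hform : ∀ h : ι → ℝ, ∑ i, ∑ j, A i j * h i * h j ≤ (∑ i, e i * h i) ^ 2 := by
    intro h
    have h1 : ∑ i, ∑ j, A i j * h i * h j = (∑ i, e i * h i) ^ 2 -
        ∑ c ∈ univ.image C, (∑ i, if C i = c then e i * h i else 0) ^ 2 := by
      have h2 : ∀ i j, (if C i = C j then (1 : ℝ) else 0) = ∑ c ∈ univ.image C,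
          (if C i = c then 1 else 0) * (if C j = c then 1 else 0) := by
        intro i j
        simp [Finset.sum_ite_eq, eq_comm (a := C i)]
      have h3 : ∀ c, (∑ i, if C i = c then e i * h i else 0) ^ 2 = ∑ i, ∑ j,
          e i * h i * (e j * h j) * ((if C i = c then 1 else 0) * (if C j = c then 1 else 0)) := by
        intro c
        rw [sq, sum_mul_sum]
        refine sum_congr rfl fun i _ => sum_congr rfl fun j _ => ?_
        split_ifs <;> simp
      simp only [h3]
      rw [sum_comm (s := univ.image C), sq, sum_mul_sum, ← sum_sub_distrib]
      refine sum_congr rfl fun i _ => ?_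
      rw [sum_comm (s := univ.image C), ← sum_sub_distrib]
      refine sum_congr rfl fun j _ => ?_
      rw [← mul_sum, ← h2, hA]; ring
    rw [h1]
    have : 0 ≤ ∑ c ∈ univ.image C, (∑ i, if C i = c then e i * h i else 0) ^ 2 :=
      sum_nonneg fun _ _ => sq_nonneg _
    linarith
  -- This function is `e`-orthogonal to constants, so the form is nonpositive on it. Multiplying by
  -- `γ` and completing the square `(b β - a γ) ^ 2` yields the reverse Cauchy–Schwarz inequality `α
  -- γ ≤ β ^ 2`.
  have h1 := hform fun i => b * g i - a
  have h2 : ∑ i, e i * (b * g i - a) = 0 := by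
    simp only [mul_sub, sum_sub_distrib, ← sum_mul]
    rw [← hb, show ∑ i, e i * (b * g i) = b * a by
      rw [ha, mul_sum]; exact sum_congr rfl fun i _ => by ring]
    ring
  rw [h2] at h1
  set α := ∑ i, ∑ j, A i j * g i * g j with hα
  set β := ∑ i, ∑ j, A i j * g i with hβ
  set γ := ∑ i, ∑ j, A i j with hγ
  have hβ' : ∑ i, ∑ j, A i j * g j = β := by
    rw [sum_comm]
    exact sum_congr rfl fun i _ => sum_congr rfl fun j _ => by rw [hsymm]
  have h3 : ∑ i, ∑ j, A i j * (b * g i - a) * (b * g j - a) =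
      b ^ 2 * α - 2 * a * b * β + a ^ 2 * γ := by
    calc _ = b ^ 2 * α - a * b * β - a * b * (∑ i, ∑ j, A i j * g j) + a ^ 2 * γ := by
          rw [hα, hβ, hγ]
          simp only [mul_sum]
          simp only [← sum_sub_distrib, ← sum_add_distrib]
          exact sum_congr rfl fun i _ => sum_congr rfl fun j _ => by ring
      _ = _ := by rw [hβ']; ring
  rw [h3] at h1
  have hγ0 : 0 ≤ γ := sum_nonneg fun i _ => sum_nonneg fun j _ => by
    rw [hA]
    refine mul_nonneg (mul_nonneg (he i) (he j)) ?_
    split_ifs <;> simp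
  have hb2 : 0 < b ^ 2 := by positivity
  refine le_of_mul_le_mul_left ?_ hb2
  nlinarith [sq_nonneg (b * β - a * γ), mul_nonneg hγ0 (sub_nonneg.2 h1)]

/-! ### Links in a uniform set family: counting identities and trickling down. -/

section SetFamily

open Finset

variable {α Ω : Type*} [DecidableEq α] [Fintype Ω]

/-- The sum of `f` over the members of the family `s` that contain `S`. -/
def upSum (s : Ω → Finset α) (S : Finset α) (f : Ω → ℝ) : ℝ :=
  ∑ T, if S ⊆ s T then f T else 0

/-- The number of members of the family `s` that contain `S`. -/
def upCount (s : Ω → Finset α) (S : Finset α) : ℝ :=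
  upSum s S fun _ => 1

/-- The sum of `f` over the members of the family `s` that contain `S` and, off `S`, the
element `i`. -/
def linkSum (s : Ω → Finset α) (S : Finset α) (f : Ω → ℝ) (i : α) : ℝ :=
  ∑ T, if S ⊆ s T ∧ i ∈ s T \ S then f T else 0

/-- The weighted adjacency matrix of the graph of the link of `S` in the family `s`. -/
def linkMatrix (s : Ω → Finset α) (S : Finset α) (i j : α) : ℝ :=
  ∑ T, if S ⊆ s T ∧ i ∈ s T \ S ∧ j ∈ s T \ S ∧ i ≠ j then 1 else 0

theorem upCount_nonneg (s : Ω → Finset α) (S : Finset α) : 0 ≤ upCount s S :=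
  sum_nonneg fun _ _ => by split_ifs <;> simp

theorem linkSum_one_nonneg (s : Ω → Finset α) (S : Finset α) (i : α) :
    0 ≤ linkSum s S (fun _ => 1) i :=
  sum_nonneg fun _ _ => by split_ifs <;> simp

theorem linkMatrix_nonneg (s : Ω → Finset α) (S : Finset α) (i j : α) :
    0 ≤ linkMatrix s S i j :=
  sum_nonneg fun _ _ => by split_ifs <;> simp

theorem linkMatrix_symm (s : Ω → Finset α) (S : Finset α) (i j : α) :
    linkMatrix s S i j = linkMatrix s S j i :=
  sum_congr rfl fun T _ => by
    congr 1
    simp only [eq_iff_iff, ne_comm (a := i)]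
    tauto

theorem upSum_insert (s : Ω → Finset α) {S : Finset α} {k : α} (hk : k ∉ S) (f : Ω → ℝ) :
    upSum s (insert k S) f = linkSum s S f k :=
  sum_congr rfl fun T _ => by
    congr 1
    simp only [eq_iff_iff, insert_subset_iff, mem_sdiff]
    tauto

/-- The degrees in the link of `insert k S` form row `k` of the link matrix of `S`; through this,
inequalities at `insert k S` become statements about `S`. -/
theorem linkSum_insert (s : Ω → Finset α) {S : Finset α} {k : α} (hk : k ∉ S) (i : α) :
    linkSum s (insert k S) (fun _ => 1) i = linkMatrix s S k i :=
  sum_congr rfl fun T _ => by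
    congr 1
    simp only [eq_iff_iff, insert_subset_iff, mem_sdiff, mem_insert, not_or, ne_comm (a := k)]
    tauto

theorem sum_linkSum [Fintype α] {s : Ω → Finset α} {r : ℕ} (hs : ∀ T, (s T).card = r) (S : Finset α)
    (f : Ω → ℝ) : ∑ i, linkSum s S f i = ((r : ℝ) - S.card) * upSum s S f := by
  unfold linkSum upSum
  rw [sum_comm, mul_sum]
  refine sum_congr rfl fun T _ => ?_
  by_cases h : S ⊆ s T
  · simp only [h, true_and, if_true, ← sum_filter, sum_const, nsmul_eq_mul]
    rw [filter_mem_eq_inter, univ_inter, card_sdiff_of_subset h, Nat.cast_sub (card_le_card h), hs]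
  · simp [h]

theorem sum_compl_linkSum [Fintype α] {s : Ω → Finset α} {r : ℕ} (hs : ∀ T, (s T).card = r)
    (S : Finset α)
    (f : Ω → ℝ) : ∑ i ∈ Sᶜ, linkSum s S f i = ((r : ℝ) - S.card) * upSum s S f := by
  rw [← sum_linkSum hs]
  refine sum_subset (subset_univ _) fun i _ hi => sum_eq_zero fun T _ => ?_
  simp only [mem_compl, not_not] at hi
  simp [hi]

theorem sum_linkMatrix [Fintype α] {s : Ω → Finset α} {r : ℕ} (hs : ∀ T, (s T).card = r)
    (S : Finset α)
    (i : α) :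
    ∑ j, linkMatrix s S i j = ((r : ℝ) - S.card - 1) * linkSum s S (fun _ => 1) i := by
  unfold linkSum linkMatrix
  rw [sum_comm, mul_sum]
  refine sum_congr rfl fun T _ => ?_
  by_cases h : S ⊆ s T ∧ i ∈ s T \ S
  · have h1 : ∀ j, (S ⊆ s T ∧ i ∈ s T \ S ∧ j ∈ s T \ S ∧ i ≠ j) ↔ j ∈ (s T \ S).erase i := by
      intro j
      simp only [h, true_and, mem_erase, ne_comm (a := i)]
      tauto
    simp only [h1, if_pos h, ← sum_filter, sum_const, nsmul_eq_mul]
    rw [filter_mem_eq_inter, univ_inter, cast_card_erase_of_mem h.2, card_sdiff_of_subset h.1,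
      Nat.cast_sub (card_le_card h.1), hs]
  · rw [if_neg h, mul_zero]
    exact sum_eq_zero fun j _ => if_neg fun h2 => h ⟨h2.1, h2.2.1⟩

theorem sum_linkMatrix_insert [Fintype α] {s : Ω → Finset α} {r : ℕ} (hs : ∀ T, (s T).card = r)
    (S : Finset α) (i j : α) :
    ∑ k ∈ Sᶜ, linkMatrix s (insert k S) i j = ((r : ℝ) - S.card - 2) * linkMatrix s S i j := by
  unfold linkMatrix
  rw [sum_comm, mul_sum]
  refine sum_congr rfl fun T _ => ?_
  by_cases h : S ⊆ s T ∧ i ∈ s T \ S ∧ j ∈ s T \ S ∧ i ≠ j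
  · have h1 : ∀ k ∈ Sᶜ, (insert k S ⊆ s T ∧ i ∈ s T \ insert k S ∧ j ∈ s T \ insert k S ∧ i ≠ j) ↔
        k ∈ ((s T \ S).erase i).erase j := by
      intro k hk
      have hk' := mem_compl.1 hk
      have h2 := h.2.1
      have h3 := h.2.2.1
      simp only [mem_sdiff] at h2 h3
      simp only [insert_subset_iff, mem_erase, mem_sdiff, mem_insert, not_or, h.1, h2, h3,
        hk', eq_comm (a := i), eq_comm (a := j)]
      simp
      tauto
    rw [sum_congr rfl fun k hk => by rw [if_congr (h1 k hk) rfl rfl]]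
    simp only [if_pos h, ← sum_filter, sum_const, nsmul_eq_mul]
    rw [filter_mem_eq_inter, inter_eq_right.2, cast_card_erase_of_mem, cast_card_erase_of_mem h.2.1,
      card_sdiff_of_subset h.1, Nat.cast_sub (card_le_card h.1), hs]
    · ring
    · exact mem_erase.2 ⟨h.2.2.2.symm, h.2.2.1⟩
    · intro k hk
      simp only [mem_erase, mem_sdiff] at hk
      simp [hk]
  · rw [if_neg h, mul_zero]
    refine sum_eq_zero fun k _ => if_neg fun h2 => h ?_
    simp only [insert_subset_iff, mem_sdiff, mem_insert, not_or] at h2 ⊢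
    tauto

/-- The log-concavity inequality for the link of `S`. -/
def LinkLogConcave [Fintype α] (s : Ω → Finset α) (S : Finset α) : Prop :=
  ∀ g : α → ℝ, (∑ i, ∑ j, linkMatrix s S i j * g i * g j) * (∑ i, ∑ j, linkMatrix s S i j) ≤
    (∑ i, ∑ j, linkMatrix s S i j * g i) ^ 2

/-- With `A` the link matrix of `S`, `D` its row sums and `m` the corank, the hypothesis at `insert
k S` bounds that link's form by `(m - 2) (A g)_k ^ 2 / D_k`. The forms add up over `k` to `m - 2`
times that of `A`, so `A ≤ A D⁻¹ A`, the input of the trickle lemma. Corank at least three makes `m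
- 2` positive. -/
theorem linkLogConcave_of_insert [Fintype α] {s : Ω → Finset α} {r : ℕ} (hs : ∀ T, (s T).card = r)
    {S : Finset α} (hS : S.card + 3 ≤ r)
    (hconn : ∀ h : α → ℝ, (∀ i j, linkMatrix s S i j ≠ 0 → h i = h j) →
      ∀ i j, linkSum s S (fun _ => 1) i ≠ 0 → linkSum s S (fun _ => 1) j ≠ 0 → h i = h j)
    (hlink : ∀ k ∉ S, LinkLogConcave s (insert k S)) : LinkLogConcave s S := by
  set m : ℝ := (r : ℝ) - S.card with hm
  have hm3 : 3 ≤ m := by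
    have : ((S.card + 3 : ℕ) : ℝ) ≤ r := by exact_mod_cast hS
    push_cast at this
    linarith
  set d := linkSum s S (fun _ => 1) with hd
  have hrow : ∀ i, ∑ j, linkMatrix s S i j = (m - 1) * d i := fun i => sum_linkMatrix hs S i
  have hq : ∀ g : α → ℝ, ∑ i, ∑ j, linkMatrix s S i j * g i * g j ≤
      ∑ k, (∑ j, linkMatrix s S k j * g j) ^ 2 / ((m - 1) * d k) := by
    intro g
    have hk : ∀ k ∈ Sᶜ, ∑ i, ∑ j, linkMatrix s (insert k S) i j * g i * g j ≤
        (m - 2) * ((∑ j, linkMatrix s S k j * g j) ^ 2 / ((m - 1) * d k)) := by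
      intro k hk
      have hk' := mem_compl.1 hk
      have hc : ((insert k S).card : ℝ) = S.card + 1 := by
        rw [card_insert_of_notMem hk']; push_cast; ring
      have hrowk : ∀ i, ∑ j, linkMatrix s (insert k S) i j = (m - 2) * linkMatrix s S k i := by
        intro i
        rw [sum_linkMatrix hs, linkSum_insert s hk', hc, hm]; ring
      have h1 := hlink k hk' g
      have h2 : ∑ i, ∑ j, linkMatrix s (insert k S) i j = (m - 2) * ((m - 1) * d k) := by
        rw [← hrow, mul_sum]
        exact sum_congr rfl fun i _ => hrowk i
      have h3 : ∑ i, ∑ j, linkMatrix s (insert k S) i j * g i =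
          (m - 2) * ∑ j, linkMatrix s S k j * g j := by
        rw [mul_sum]
        exact sum_congr rfl fun i _ => by rw [← sum_mul, hrowk]; ring
      rw [h2, h3] at h1
      rcases (linkSum_one_nonneg s S k).eq_or_lt with h0 | h0
      · have hz : ∀ i j, linkMatrix s (insert k S) i j = 0 := by
          have h4 : ∑ i, ∑ j, linkMatrix s (insert k S) i j = 0 := by
            rw [h2, hd, ← h0]; ring
          intro i j
          have h5 := (sum_eq_zero_iff_of_nonneg fun i _ => sum_nonneg fun j _ =>
            linkMatrix_nonneg s (insert k S) i j).1 h4 i (mem_univ i)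
          exact (sum_eq_zero_iff_of_nonneg fun j _ =>
            linkMatrix_nonneg s (insert k S) i j).1 h5 j (mem_univ j)
        simp [hz, hd, ← h0]
      · have hpos : 0 < (m - 1) * d k := mul_pos (by linarith) h0
        rw [← mul_div_assoc, le_div_iff₀ hpos]
        have : 0 < m - 2 := by linarith
        refine le_of_mul_le_mul_left ?_ this
        linarith
    have hsum := sum_le_sum hk
    have hL : ∑ k ∈ Sᶜ, ∑ i, ∑ j, linkMatrix s (insert k S) i j * g i * g j =
        (m - 2) * ∑ i, ∑ j, linkMatrix s S i j * g i * g j := by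
      rw [sum_comm, mul_sum]
      refine sum_congr rfl fun i _ => ?_
      rw [sum_comm, mul_sum]
      refine sum_congr rfl fun j _ => ?_
      rw [← sum_mul, ← sum_mul, sum_linkMatrix_insert hs]; ring
    rw [hL, ← mul_sum] at hsum
    refine (le_of_mul_le_mul_left hsum (by linarith)).trans ?_
    refine sum_le_univ_sum_of_nonneg fun k => div_nonneg (sq_nonneg _) ?_
    exact mul_nonneg (by linarith) (linkSum_one_nonneg s S k)
  intro g
  have := quadForm_mul_le_sq_of_trickle (linkMatrix s S) (fun i => (m - 1) * d i)
    (linkMatrix_symm s S) (linkMatrix_nonneg s S) hrow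
    (fun h hh i j hi hj => hconn h hh i j (right_ne_zero_of_mul hi) (right_ne_zero_of_mul hj)) hq g
  simpa only [hrow, ← sum_mul] using this

/-! ### From link inequalities to variance inequalities. -/

/-- The variance, up to normalization, of `f` on the members of the family containing `S`. -/
noncomputable def upVar (s : Ω → Finset α) (S : Finset α) (f : Ω → ℝ) : ℝ :=
  upSum s S (fun T => f T ^ 2) - upSum s S f ^ 2 / upCount s S

theorem linkSum_eq_zero {s : Ω → Finset α} {S : Finset α} {k : α}
    (h : linkSum s S (fun _ => 1) k = 0) (f : Ω → ℝ) : linkSum s S f k = 0 := by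
  refine sum_eq_zero fun T _ => if_neg fun hT => ?_
  have := (sum_eq_zero_iff_of_nonneg fun T _ => by split_ifs <;> simp).1 h T (mem_univ T)
  simp [hT] at this

theorem upSum_eq_zero {s : Ω → Finset α} {S : Finset α}
    (h : upCount s S = 0) (f : Ω → ℝ) : upSum s S f = 0 := by
  refine sum_eq_zero fun T _ => if_neg fun hT => ?_
  have := (sum_eq_zero_iff_of_nonneg fun T _ => by split_ifs <;> simp).1 h T (mem_univ T)
  simp [hT] at this

/-- Contraction of the variance from the members of the family to the elements. -/
theorem sum_sq_linkSum_div_le [Fintype α] {s : Ω → Finset α} {r : ℕ} (hs : ∀ T, (s T).card = r)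
    {S : Finset α} (hS : S.card + 2 ≤ r) (hlc : LinkLogConcave s S) (f : Ω → ℝ) :
    ∑ k, linkSum s S f k ^ 2 / linkSum s S (fun _ => 1) k ≤
      upSum s S (fun T => f T ^ 2) +
        ((r : ℝ) - S.card - 1) * (upSum s S f ^ 2 / upCount s S) := by
  set m : ℝ := (r : ℝ) - S.card with hm
  have hm2 : 2 ≤ m := by
    have : ((S.card + 2 : ℕ) : ℝ) ≤ r := by exact_mod_cast hS
    push_cast at this
    linarith
  set d := linkSum s S (fun _ => 1) with hd
  set F := upSum s S f with hF
  set N := upCount s S with hN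
  rcases (upCount_nonneg s S).eq_or_lt with h0 | h0
  · have h1 : ∀ k, linkSum s S f k = 0 := by
      intro k
      refine sum_eq_zero fun T _ => if_neg fun hT => ?_
      have := (sum_eq_zero_iff_of_nonneg fun T _ => by split_ifs <;> simp).1 h0.symm T (mem_univ T)
      simp [hT.1] at this
    simp [h1, hF, upSum_eq_zero h0.symm, hN, ← h0]
  -- The mean of `f` over the members containing `S` and `k`; `G` below sums these means over the
  -- elements of a member.
  let g : α → ℝ := fun k => linkSum s S f k / d k
  have hdg : ∀ k, d k * g k = linkSum s S f k := by
    intro k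
    by_cases h : d k = 0
    · rw [h, zero_mul, linkSum_eq_zero h]
    · simp only [g]; field_simp
  let G : Ω → ℝ := fun T => ∑ k ∈ s T \ S, g k
  have hswap : ∀ φ : Ω → ℝ, upSum s S (fun T => φ T * G T) = ∑ k, linkSum s S φ k * g k := by
    intro φ
    simp only [linkSum, upSum, sum_mul]
    rw [sum_comm]
    refine sum_congr rfl fun T _ => ?_
    by_cases h : S ⊆ s T
    · simp only [h, true_and, if_true, G, mul_sum, ite_mul, zero_mul]
      rw [← sum_filter, filter_mem_eq_inter, univ_inter]
    · simp [h]
  set X := ∑ k, linkSum s S f k ^ 2 / d k with hX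
  have hX1 : upSum s S (fun T => f T * G T) = X := by
    rw [hswap]
    exact sum_congr rfl fun k _ => by simp only [g]; ring
  have hG1 : upSum s S G = m * F := by
    have := hswap fun _ => 1
    simp only [one_mul] at this
    rw [show upSum s S G = upSum s S (fun T => G T) from rfl, this, hF, ← sum_linkSum hs]
    exact sum_congr rfl fun k _ => hdg k
  have hX2 : ∑ k, d k * g k ^ 2 = X := by
    refine sum_congr rfl fun k _ => ?_
    rw [sq, ← mul_assoc, hdg]; simp only [g]; ring
  have hrow : ∀ i, ∑ j, linkMatrix s S i j = (m - 1) * d i := fun i => sum_linkMatrix hs S i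
  have hQ1 : ∑ i, ∑ j, linkMatrix s S i j = (m - 1) * (m * N) := by
    simp only [hrow, ← mul_sum]
    rw [hd, sum_linkSum hs]; rfl
  have hQg : ∑ i, ∑ j, linkMatrix s S i j * g i = (m - 1) * (m * F) := by
    simp only [← sum_mul, hrow, mul_assoc, hdg, ← mul_sum]
    rw [sum_linkSum hs]
  have hGG : upSum s S (fun T => G T ^ 2) =
      X + ∑ i, ∑ j, linkMatrix s S i j * g i * g j := by
    have h1 : ∑ i, ∑ j, linkMatrix s S i j * g i * g j =
        ∑ T, if S ⊆ s T then G T ^ 2 - ∑ i ∈ s T \ S, g i ^ 2 else 0 := by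
      simp only [linkMatrix, sum_mul]
      rw [sum_congr rfl fun i _ => sum_comm, sum_comm]
      refine sum_congr rfl fun T _ => ?_
      by_cases h : S ⊆ s T
      · simp only [h, true_and, if_true, G]
        have h2 : ∀ i, i ∈ s T \ S → ∑ j, (if i ∈ s T \ S ∧ j ∈ s T \ S ∧ i ≠ j then (1 : ℝ) else 0)
            * g i * g j = g i * (∑ j ∈ s T \ S, g j) - g i ^ 2 := by
          intro i hi
          rw [← add_sum_erase _ _ hi]
          have h3 : ∀ j, (i ∈ s T \ S ∧ j ∈ s T \ S ∧ i ≠ j) ↔ j ∈ (s T \ S).erase i := by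
            intro j
            simp only [hi, true_and, mem_erase, ne_comm (a := i)]
            tauto
          simp only [h3, ite_mul, one_mul, zero_mul]
          rw [← sum_filter, filter_mem_eq_inter, univ_inter, ← mul_sum]
          ring
        rw [sq (∑ k ∈ s T \ S, g k), sum_mul, ← sum_sub_distrib, ← sum_congr rfl h2]
        refine (sum_subset (subset_univ _) fun i _ hi => ?_).symm
        exact sum_eq_zero fun j _ => by simp [hi]
      · simp [h]
    have h2 : X = upSum s S fun T => ∑ i ∈ s T \ S, g i ^ 2 := by
      rw [← hX2]
      simp only [hd, linkSum, upSum, sum_mul]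
      rw [sum_comm]
      refine sum_congr rfl fun T _ => ?_
      by_cases h : S ⊆ s T
      · simp only [h, true_and, if_true, ite_mul, zero_mul, one_mul]
        rw [← sum_filter, filter_mem_eq_inter, univ_inter]
      · simp [h]
    rw [h1, h2]
    unfold upSum
    rw [← sum_add_distrib]
    exact sum_congr rfl fun T _ => by split_ifs <;> ring
  have hQ : ∑ i, ∑ j, linkMatrix s S i j * g i * g j ≤ (m - 1) * m * (F ^ 2 / N) := by
    have h1 := hlc g
    rw [hQ1, hQg] at h1
    have h2 : 0 < (m - 1) * m := by nlinarith
    rw [← mul_div_assoc, le_div_iff₀ h0]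
    refine le_of_mul_le_mul_left ?_ h2
    linarith
  -- The sum `G` has mean `m F / N`, so the constant `(m - 1) F / N` gives the residual mean zero.
  -- Expanding the square and inserting `hQ` leaves exactly the claim.
  have hsq : 0 ≤ upSum s S fun T => (f T - G T + (m - 1) * (F / N)) ^ 2 :=
    sum_nonneg fun T _ => by split_ifs <;> positivity
  have hexp : upSum s S (fun T => (f T - G T + (m - 1) * (F / N)) ^ 2) =
      upSum s S (fun T => f T ^ 2) - 2 * upSum s S (fun T => f T * G T) +
      upSum s S (fun T => G T ^ 2) + 2 * ((m - 1) * (F / N)) * F -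
      2 * ((m - 1) * (F / N)) * upSum s S G + ((m - 1) * (F / N)) ^ 2 * N := by
    rw [hF, hN]
    unfold upCount upSum
    simp only [mul_sum, ← sum_sub_distrib, ← sum_add_distrib]
    exact sum_congr rfl fun T _ => by split_ifs <;> ring
  rw [hexp, hX1, hG1, hGG] at hsq
  have hN2 : (F / N) ^ 2 * N = F ^ 2 / N := by field_simp
  have hN3 : F / N * F = F ^ 2 / N := by ring
  have e1 : 2 * ((m - 1) * (F / N)) * F = 2 * (m - 1) * (F ^ 2 / N) := by rw [← hN3]; ring
  have e2 : 2 * ((m - 1) * (F / N)) * (m * F) = 2 * (m - 1) * m * (F ^ 2 / N) := by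
    rw [← hN3]; ring
  have e3 : ((m - 1) * (F / N)) ^ 2 * N = (m - 1) ^ 2 * (F ^ 2 / N) := by rw [← hN2]; ring
  rw [e1, e2, e3] at hsq
  nlinarith

/-- The variance is bounded by the sum of the local variances at the sets of corank one. -/
theorem upVar_le_sum [Fintype α] {s : Ω → Finset α} {r : ℕ} (hs : ∀ T, (s T).card = r)
    (hlc : ∀ S : Finset α, S.card + 2 ≤ r → LinkLogConcave s S) (f : Ω → ℝ) (m : ℕ) :
    ∀ S : Finset α, S.card + (m + 1) = r →
      upVar s S f ≤ ∑ U : Finset α, if S ⊆ U ∧ U.card + 1 = r then upVar s U f else 0 := by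
  induction m with
  | zero =>
    intro S hS
    have h1 : ∀ U : Finset α, (S ⊆ U ∧ U.card + 1 = r) ↔ U = S := by
      intro U
      constructor
      · rintro ⟨h, hU⟩
        exact (eq_of_subset_of_card_le h (by omega)).symm
      · rintro rfl
        exact ⟨Subset.rfl, by omega⟩
    simp [h1]
  | succ m ih =>
    intro S hS
    have h1 : ∀ k ∈ Sᶜ, upVar s (insert k S) f ≤
        ∑ U : Finset α, if insert k S ⊆ U ∧ U.card + 1 = r then upVar s U f else 0 := by
      intro k hk
      refine ih _ ?_
      rw [card_insert_of_notMem (mem_compl.1 hk)]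
      omega
    have h2 := sum_le_sum h1
    have hcast : (r : ℝ) - S.card = m + 2 := by
      rw [← hS]; push_cast; ring
    -- Each `U` of corank one above `S` is reached through its `m + 1` elements outside `S`; this
    -- matches the factor that the contraction yields on the left.
    have hR : ∑ k ∈ Sᶜ, ∑ U : Finset α,
          (if insert k S ⊆ U ∧ U.card + 1 = r then upVar s U f else 0) =
        ((m : ℝ) + 1) * ∑ U : Finset α, if S ⊆ U ∧ U.card + 1 = r then upVar s U f else 0 := by
      rw [sum_comm, mul_sum]
      refine sum_congr rfl fun U _ => ?_
      by_cases h : S ⊆ U ∧ U.card + 1 = r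
      · have h3 : ∀ k ∈ Sᶜ, (insert k S ⊆ U ∧ U.card + 1 = r) ↔ k ∈ U \ S := by
          intro k hk
          simp only [insert_subset_iff, h, and_true, mem_sdiff, mem_compl.1 hk, not_false_eq_true]
        rw [sum_congr rfl fun k hk => by rw [if_congr (h3 k hk) rfl rfl], ← sum_filter,
          filter_mem_eq_inter, inter_eq_right.2, sum_const, card_sdiff_of_subset h.1, if_pos h,
          nsmul_eq_mul, show U.card - S.card = m + 1 by omega]
        · push_cast; ring
        · intro k hk
          exact mem_compl.2 (mem_sdiff.1 hk).2
      · rw [if_neg h, mul_zero]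
        exact sum_eq_zero fun k _ => if_neg fun h3 =>
          h ⟨(subset_insert k S).trans h3.1, h3.2⟩
    have hL : ∑ k ∈ Sᶜ, upVar s (insert k S) f = ((m : ℝ) + 2) * upSum s S (fun T => f T ^ 2) -
        ∑ k, linkSum s S f k ^ 2 / linkSum s S (fun _ => 1) k := by
      unfold upVar
      rw [sum_sub_distrib]
      congr 1
      · rw [sum_congr rfl fun k hk => upSum_insert s (mem_compl.1 hk) _,
          sum_compl_linkSum hs, hcast]
      · rw [sum_congr rfl fun k hk => by
          rw [upCount, upSum_insert s (mem_compl.1 hk), upSum_insert s (mem_compl.1 hk)]]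
        refine sum_subset (subset_univ _) fun i _ hi => ?_
        simp only [mem_compl, not_not] at hi
        have : linkSum s S f i = 0 := sum_eq_zero fun T _ => by simp [hi]
        simp [this]
    have h4 := sum_sq_linkSum_div_le hs (S := S) (by omega) (hlc S (by omega)) f
    rw [hL, hR] at h2
    rw [hcast] at h4
    have h5 : (0 : ℝ) < m + 1 := by positivity
    refine le_of_mul_le_mul_left ?_ h5
    refine le_trans ?_ h2
    unfold upVar
    linarith

end SetFamily

/-! ### The links of the family of bases of a matroid. -/

section Bases

open Finset

variable {α Ω : Type*} {M : Matroid α} {s : Ω → Finset α}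

/-- Parallelism in `M / S` is equality of closures, hence an equivalence relation; this makes the
graph of non-parallel pairs complete multipartite. -/
theorem Matroid.closure_insert_eq_iff {S : Set α} {i j : α} (hi : i ∉ S)
    (hiS : M.Indep (insert i S)) (hjS : M.Indep (insert j S)) :
    M.closure (insert i S) = M.closure (insert j S) ↔
      ¬ (i ≠ j ∧ M.Indep (insert i (insert j S))) := by
  constructor
  · rintro h ⟨hij, hI⟩
    have h1 := (hjS.notMem_closure_iff (hiS.subset_ground (Set.mem_insert i S))).2
      ⟨hI, by simp [hij, hi]⟩
    rw [← h] at h1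
    exact h1 (M.subset_closure _ hiS.subset_ground (Set.mem_insert i S))
  · intro h
    by_cases hij : i = j
    · rw [hij]
    refine Matroid.closure_insert_congr ⟨?_, ?_⟩
    · by_contra h1
      exact h ⟨hij, ((hjS.notMem_closure_iff (hiS.subset_ground (Set.mem_insert i S))).1 h1).1⟩
    · have hS : M.Indep S := hiS.subset (Set.subset_insert i S)
      exact (hS.notMem_closure_iff (hiS.subset_ground (Set.mem_insert i S))).2 ⟨hiS, hi⟩

theorem exists_subset_iff_indep [Finite α]
    (hB : ∀ X : Finset α, M.IsBase (X : Set α) ↔ ∃ T, s T = X) (X : Finset α) :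
    (∃ T, X ⊆ s T) ↔ M.Indep (X : Set α) := by
  constructor
  · rintro ⟨T, hT⟩
    exact ((hB (s T)).2 ⟨T, rfl⟩).indep.subset (by exact_mod_cast hT)
  · intro h
    obtain ⟨Y, hY, hXY⟩ := h.exists_isBase_superset
    lift Y to Finset α using Set.toFinite Y
    obtain ⟨T, rfl⟩ := (hB Y).1 hY
    exact ⟨T, by exact_mod_cast hXY⟩

variable [DecidableEq α] [Fintype Ω]

theorem linkSum_ne_zero_iff [Finite α]
    (hB : ∀ X : Finset α, M.IsBase (X : Set α) ↔ ∃ T, s T = X) (S : Finset α) (i : α) :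
    linkSum s S (fun _ => 1) i ≠ 0 ↔ i ∉ S ∧ M.Indep (insert i (S : Set α)) := by
  rw [← coe_insert, ← exists_subset_iff_indep hB, linkSum, Ne,
    sum_eq_zero_iff_of_nonneg fun T _ => by split_ifs <;> simp]
  simp only [mem_univ, true_imp_iff, ite_eq_right_iff, one_ne_zero, imp_false, not_forall,
    not_not, insert_subset_iff, mem_sdiff]
  constructor
  · rintro ⟨T, h⟩
    exact ⟨h.2.2, T, h.2.1, h.1⟩
  · rintro ⟨h, T, h2⟩
    exact ⟨T, h2.2, h2.1, h⟩

theorem linkMatrix_ne_zero_iff [Finite α]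
    (hB : ∀ X : Finset α, M.IsBase (X : Set α) ↔ ∃ T, s T = X) (S : Finset α) (i j : α) :
    linkMatrix s S i j ≠ 0 ↔
      i ∉ S ∧ j ∉ S ∧ i ≠ j ∧ M.Indep (insert i (insert j (S : Set α))) := by
  rw [← coe_insert, ← coe_insert, ← exists_subset_iff_indep hB, linkMatrix, Ne,
    sum_eq_zero_iff_of_nonneg fun T _ => by split_ifs <;> simp]
  simp only [mem_univ, true_imp_iff, ite_eq_right_iff, one_ne_zero, imp_false, not_forall,
    not_not, insert_subset_iff, mem_sdiff]
  constructor
  · rintro ⟨T, h⟩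
    exact ⟨h.2.1.2, h.2.2.1.2, h.2.2.2, T, h.2.1.1, h.2.2.1.1, h.1⟩
  · rintro ⟨h, h', hij, T, h2⟩
    exact ⟨T, h2.2.2, ⟨h2.1, h⟩, ⟨h2.2.1, h'⟩, hij⟩

/-- The graph of the link of an independent set of corank at least two is connected. -/
theorem link_connected [Finite α]
    (hB : ∀ X : Finset α, M.IsBase (X : Set α) ↔ ∃ T, s T = X) {r : ℕ}
    (hs : ∀ T, (s T).card = r) {S : Finset α} (hS : S.card + 2 ≤ r) (h : α → ℝ)
    (hh : ∀ i j, linkMatrix s S i j ≠ 0 → h i = h j) (i j : α)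
    (hi : linkSum s S (fun _ => 1) i ≠ 0) (hj : linkSum s S (fun _ => 1) j ≠ 0) : h i = h j := by
  have hi' := (linkSum_ne_zero_iff hB S i).1 hi
  have hj' := (linkSum_ne_zero_iff hB S j).1 hj
  by_cases hij : i ≠ j ∧ M.Indep (insert i (insert j (S : Set α)))
  · exact hh i j ((linkMatrix_ne_zero_iff hB S i j).2 ⟨hi'.1, hj'.1, hij⟩)
  have hcl := (Matroid.closure_insert_eq_iff hi'.1 hi'.2 hj'.2).2 hij
  obtain ⟨T, hT⟩ := (exists_subset_iff_indep hB (insert i S)).2 (by simpa using hi'.2)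
  -- Two non-adjacent elements are parallel. Corank two leaves room for a `k` not parallel to `i`,
  -- hence not to `j`, so `i, k, j` is a path.
  obtain ⟨k, hkT, hk⟩ : ∃ k ∈ s T, k ∉ insert i S := by
    by_contra! hcon
    have := card_le_card hcon
    rw [hs, card_insert_of_notMem hi'.1] at this
    omega
  have hki : M.Indep (insert k (insert i (S : Set α))) := by
    have := (exists_subset_iff_indep hB (insert k (insert i S))).1
      ⟨T, insert_subset hkT hT⟩
    simpa using this
  simp only [mem_insert, not_or] at hk
  have hkS : M.Indep (insert k (S : Set α)) :=
    hki.subset (Set.insert_subset_insert (Set.subset_insert _ _))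
  have hne : M.closure (insert k (S : Set α)) ≠ M.closure (insert i (S : Set α)) := fun h1 =>
    (Matroid.closure_insert_eq_iff hk.2 hkS hi'.2).1 h1 ⟨hk.1, hki⟩
  rw [hcl, Ne, Matroid.closure_insert_eq_iff hk.2 hkS hj'.2, not_not] at hne
  rw [← hh k i ((linkMatrix_ne_zero_iff hB S k i).2 ⟨hk.2, hi'.1, hk.1, hki⟩),
    ← hh k j ((linkMatrix_ne_zero_iff hB S k j).2 ⟨hk.2, hj'.1, hne⟩)]

/-- Here `S ∪ {i, j}` is itself a basis or lies in none, and by injectivity it is counted once, so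
the link matrix is the 0-1 matrix of the multipartite graph. -/
theorem linkLogConcave_of_corank_two [Fintype α]
    (hB : ∀ X : Finset α, M.IsBase (X : Set α) ↔ ∃ T, s T = X) (hinj : Function.Injective s)
    {r : ℕ} (hs : ∀ T, (s T).card = r) {S : Finset α} (hS : S.card + 2 = r) :
    LinkLogConcave s S := by
  classical
  refine quadForm_mul_le_sq_of_multipartite (linkMatrix s S)
    (fun i => if i ∉ S ∧ M.Indep (insert i (S : Set α)) then 1 else 0)
    (fun i => M.closure (insert i (S : Set α))) (fun i j => ?_)
    (fun i => by split_ifs <;> simp)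
  by_cases h : linkMatrix s S i j = 0
  · rw [h]
    by_cases hi : i ∉ S ∧ M.Indep (insert i (S : Set α))
    · by_cases hj : j ∉ S ∧ M.Indep (insert j (S : Set α))
      · have h1 := mt (linkMatrix_ne_zero_iff hB S i j).2 (not_not.2 h)
        have h2 := (Matroid.closure_insert_eq_iff hi.1 hi.2 hj.2).2
          fun h2 => h1 ⟨hi.1, hj.1, h2⟩
        simp [h2]
      · rw [if_neg hj]; ring
    · rw [if_neg hi]; ring
  · obtain ⟨hi, hj, hij, hI⟩ := (linkMatrix_ne_zero_iff hB S i j).1 h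
    have hjI : M.Indep (insert j (S : Set α)) := hI.subset (Set.subset_insert _ _)
    have hiI : M.Indep (insert i (S : Set α)) :=
      hI.subset (Set.insert_subset_insert (Set.subset_insert _ _))
    rw [if_pos ⟨hi, hiI⟩, if_pos ⟨hj, hjI⟩,
      if_neg fun h1 => (Matroid.closure_insert_eq_iff hi hiI hjI).1 h1 ⟨hij, hI⟩]
    obtain ⟨T, hT⟩ := (exists_subset_iff_indep hB (insert i (insert j S))).2 (by simpa using hI)
    have hcard : (insert i (insert j S)).card = r := by
      rw [card_insert_of_notMem (by simp [hij, hi]), card_insert_of_notMem hj]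
      omega
    have huniq : ∀ T', (S ⊆ s T' ∧ i ∈ s T' \ S ∧ j ∈ s T' \ S ∧ i ≠ j) ↔ T' = T := by
      intro T'
      constructor
      · rintro ⟨h1, h2, h3, -⟩
        apply hinj
        have h4 : insert i (insert j S) ⊆ s T' :=
          insert_subset (mem_sdiff.1 h2).1 (insert_subset (mem_sdiff.1 h3).1 h1)
        rw [← eq_of_subset_of_card_le h4 (by rw [hs, hcard]),
          ← eq_of_subset_of_card_le hT (by rw [hs, hcard])]
      · rintro rfl
        simp only [insert_subset_iff] at hT
        exact ⟨hT.2.2, mem_sdiff.2 ⟨hT.1, hi⟩, mem_sdiff.2 ⟨hT.2.1, hj⟩, hij⟩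
    simp only [linkMatrix, huniq]
    simp

theorem linkLogConcave_of_isBase [Fintype α]
    (hB : ∀ X : Finset α, M.IsBase (X : Set α) ↔ ∃ T, s T = X) (hinj : Function.Injective s)
    {r : ℕ} (hs : ∀ T, (s T).card = r) (m : ℕ) :
    ∀ S : Finset α, S.card + (m + 2) = r → LinkLogConcave s S := by
  induction m with
  | zero => exact fun S hS => linkLogConcave_of_corank_two hB hinj hs hS
  | succ m ih =>
    intro S hS
    refine linkLogConcave_of_insert hs (by omega) (link_connected hB hs (by omega)) fun k hk => ?_
    refine ih _ ?_
    rw [card_insert_of_notMem hk]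
    omega

/-- The Poincaré inequality for the down-up walk on the bases of a matroid. -/
theorem upVar_empty_le_sum [Fintype α]
    (hB : ∀ X : Finset α, M.IsBase (X : Set α) ↔ ∃ T, s T = X) (hinj : Function.Injective s)
    {r : ℕ} (hr : 1 ≤ r) (hs : ∀ T, (s T).card = r) (f : Ω → ℝ) :
    upVar s ∅ f ≤ ∑ U : Finset α, if U.card + 1 = r then upVar s U f else 0 := by
  have := upVar_le_sum hs (fun S hS => linkLogConcave_of_isBase hB hinj hs (r - S.card - 2) S
    (by omega)) f (r - 1) ∅ (by rw [card_empty]; omega)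
  simpa using this

end Bases

/-! ### Spectral gap and `ℓ¹` convergence of the walk. -/

section Walk

open Finset Matrix

/-- As `P` is positive semidefinite, Cauchy–Schwarz for its form gives `‖xP‖⁴ ≤ Q(x) Q(xP)`. Hence
the upper bound `l` on the form suffices, and no separate control of negative eigenvalues is needed.
-/
theorem sum_sq_vecMul_le {Ω ι : Type*} [Fintype Ω] [Fintype ι] {P : Matrix Ω Ω ℝ}
    {c : ι → ℝ} {a : ι → Ω → ℝ} (hc : ∀ u, 0 ≤ c u)
    (hP : ∀ τ σ, P τ σ = ∑ u, c u * a u τ * a u σ) (hrow : ∀ τ, ∑ σ, P τ σ = 1) {l : ℝ}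
    (hl : ∀ x : Ω → ℝ, ∑ τ, x τ = 0 → ∑ u, c u * (∑ τ, a u τ * x τ) ^ 2 ≤ l * ∑ τ, x τ ^ 2)
    {x : Ω → ℝ} (hx : ∑ τ, x τ = 0) :
    ∑ σ, (x ᵥ* P) σ = 0 ∧ ∑ σ, (x ᵥ* P) σ ^ 2 ≤ l ^ 2 * ∑ τ, x τ ^ 2 := by
  have hy0 : ∑ σ, (x ᵥ* P) σ = 0 := by
    simp only [vecMul, dotProduct]
    rw [sum_comm, ← hx]
    exact sum_congr rfl fun τ _ => by rw [← mul_sum, hrow, mul_one]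
  refine ⟨hy0, ?_⟩
  set y := x ᵥ* P with hy
  have h1 : ∑ σ, y σ ^ 2 = ∑ u, c u * (∑ τ, a u τ * x τ) * (∑ τ, a u τ * y τ) := by
    have h2 : ∀ σ, y σ = ∑ u, c u * (∑ τ, a u τ * x τ) * a u σ := by
      intro σ
      simp only [hy, vecMul, dotProduct, hP, mul_sum, sum_mul]
      rw [sum_comm]
      exact sum_congr rfl fun u _ => sum_congr rfl fun τ _ => by ring
    calc _ = ∑ σ, (∑ u, c u * (∑ τ, a u τ * x τ) * a u σ) * y σ :=
          sum_congr rfl fun σ _ => by rw [← h2, sq]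
      _ = _ := by
          rw [sum_congr rfl fun σ _ => sum_mul _ _ _, sum_comm]
          refine sum_congr rfl fun u _ => ?_
          exact (sum_congr rfl fun σ _ => by ring).trans (mul_sum _ _ _).symm
  have h2 : (∑ σ, y σ ^ 2) ^ 2 ≤ (∑ u, c u * (∑ τ, a u τ * x τ) ^ 2) *
      ∑ u, c u * (∑ τ, a u τ * y τ) ^ 2 := by
    rw [h1]
    exact sum_sq_le_sum_mul_sum_of_sq_le_mul _ (fun u _ => mul_nonneg (hc u) (sq_nonneg _))
      (fun u _ => mul_nonneg (hc u) (sq_nonneg _)) fun u _ => le_of_eq (by ring)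
  have h3 := mul_le_mul (hl x hx) (hl y hy0)
    (sum_nonneg fun u _ => mul_nonneg (hc u) (sq_nonneg _))
    ((sum_nonneg fun u _ => mul_nonneg (hc u) (sq_nonneg _)).trans (hl x hx))
  rcases (sum_nonneg fun σ (_ : σ ∈ univ) => sq_nonneg (y σ)).eq_or_lt with h0 | h0
  · rw [← h0]
    exact mul_nonneg (sq_nonneg _) (sum_nonneg fun τ _ => sq_nonneg _)
  · refine le_of_mul_le_mul_right ?_ h0
    linarith

theorem sq_sum_abs_pow_sub_le {Ω ι : Type*} [Fintype Ω] [DecidableEq Ω] [Fintype ι]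
    {P : Matrix Ω Ω ℝ} {c : ι → ℝ} {a : ι → Ω → ℝ} (hc : ∀ u, 0 ≤ c u)
    (hP : ∀ τ σ, P τ σ = ∑ u, c u * a u τ * a u σ) (hrow : ∀ τ, ∑ σ, P τ σ = 1) {l : ℝ}
    (hl : ∀ x : Ω → ℝ, ∑ τ, x τ = 0 → ∑ u, c u * (∑ τ, a u τ * x τ) ^ 2 ≤ l * ∑ τ, x τ ^ 2)
    (τ : Ω) (t : ℕ) :
    (∑ σ, |(P ^ t) τ σ - 1 / (Fintype.card Ω : ℝ)|) ^ 2 ≤ (Fintype.card Ω : ℝ) * (l ^ t) ^ 2 := by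
  set N : ℝ := (Fintype.card Ω : ℝ) with hN
  have hN0 : 0 < N := by
    have : 0 < Fintype.card Ω := Fintype.card_pos_iff.2 ⟨τ⟩
    rw [hN]; exact_mod_cast this
  have hsymm : ∀ τ σ, P τ σ = P σ τ := fun τ σ => by
    rw [hP, hP]; exact sum_congr rfl fun u _ => by ring
  have hind : ∑ σ, ((P ^ t) τ σ - 1 / N) = 0 ∧
      ∑ σ, ((P ^ t) τ σ - 1 / N) ^ 2 ≤ (l ^ t) ^ 2 := by
    induction t with
    | zero =>
      have h1 : ∑ σ, (1 : Matrix Ω Ω ℝ) τ σ = 1 := by simp [Matrix.one_apply]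
      have h2 : ∑ _σ : Ω, 1 / N = 1 := by
        rw [sum_const, card_univ, nsmul_eq_mul, ← hN]; field_simp
      refine ⟨by rw [pow_zero, sum_sub_distrib, h1, h2, sub_self], ?_⟩
      -- The squared distance from a point mass to uniform is `1 - 1 / N ≤ 1`.
      have h3 : ∀ σ, ((1 : Matrix Ω Ω ℝ) τ σ - 1 / N) ^ 2 =
          (1 : Matrix Ω Ω ℝ) τ σ * (1 - 2 * (1 / N)) + (1 / N) * (1 / N) := by
        intro σ
        by_cases h : τ = σ
        · rw [← h, Matrix.one_apply_eq]; ring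
        · rw [Matrix.one_apply_ne h]; ring
      simp only [pow_zero, h3, sum_add_distrib, ← sum_mul, h1, h2]
      have : 0 ≤ 1 / N := by positivity
      linarith
    | succ t ih =>
      have h1 : ∀ σ, (P ^ (t + 1)) τ σ - 1 / N = ((fun ρ => (P ^ t) τ ρ - 1 / N) ᵥ* P) σ := by
        intro σ
        simp only [pow_succ, mul_apply, vecMul, dotProduct, sub_mul, sum_sub_distrib, ← mul_sum]
        rw [sum_congr rfl fun ρ _ => hsymm ρ σ, hrow, mul_one]
      have h2 := sum_sq_vecMul_le hc hP hrow hl ih.1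
      simp only [h1]
      refine ⟨h2.1, h2.2.trans ?_⟩
      calc l ^ 2 * ∑ σ, ((P ^ t) τ σ - 1 / N) ^ 2 ≤ l ^ 2 * (l ^ t) ^ 2 :=
            mul_le_mul_of_nonneg_left ih.2 (sq_nonneg _)
        _ = _ := by ring
  calc _ ≤ N * ∑ σ, |(P ^ t) τ σ - 1 / N| ^ 2 := by
        rw [hN, ← card_univ]; exact sq_sum_le_card_mul_sum_sq
    _ ≤ _ := by
        simp only [sq_abs]
        exact mul_le_mul_of_nonneg_left hind.2 hN0.le

/-- Replaces the dropped element by the set that remains, so that the walk is indexed by the sets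
`U` of size `r - 1`. -/
theorem sum_erase_eq {α : Type*} [Fintype α] [DecidableEq α] {r : ℕ} {T : Finset α}
    (hT : T.card = r) (φ : Finset α → ℝ) :
    ∑ i ∈ T, φ (T.erase i) = ∑ U : Finset α, if U.card + 1 = r ∧ U ⊆ T then φ U else 0 := by
  rw [← sum_filter, ← sum_image (f := φ) (g := fun i => T.erase i) (erase_injOn T)]
  refine sum_congr ?_ fun _ _ => rfl
  ext U
  simp only [mem_image, mem_filter, mem_univ, true_and]
  constructor
  · rintro ⟨i, hi, rfl⟩
    exact ⟨by rw [card_erase_add_one hi, hT], erase_subset i T⟩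
  · rintro ⟨hU, hUT⟩
    obtain ⟨i, hi⟩ : ∃ i, T \ U = {i} := by
      rw [← card_eq_one, card_sdiff_of_subset hUT]; omega
    have hiT : i ∈ T \ U := by rw [hi]; exact mem_singleton_self i
    refine ⟨i, (mem_sdiff.1 hiT).1, ?_⟩
    rw [erase_eq, ← hi, Finset.sdiff_sdiff_eq_self hUT]

variable {α : Type*} {M : Matroid α}

theorem uniformOnBases_ne_zero_iff [Fintype α] (X : Finset α) :
    uniformOnBases M X ≠ 0 ↔ M.IsBase (X : Set α) := by
  refine ⟨fun h => ?_, uniformOnBases_ne_zero⟩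
  by_contra h1
  exact h (if_neg h1)

theorem uniformOnBases_apply [Fintype α] (σ : SetSupport (uniformOnBases M)) :
    uniformOnBases M σ.1 = 1 / (Fintype.card (SetSupport (uniformOnBases M)) : ℝ) := by
  classical
  have h := (uniformOnBases_ne_zero_iff σ.1).1 σ.2
  rw [uniformOnBases, if_pos h, Fintype.card_subtype]
  congr 3
  ext X
  simp [uniformOnBases_ne_zero_iff]

/-- The walk on bases contracts the total variation distance to the uniform distribution. -/
theorem sq_sum_abs_downUpWalk_pow_sub_le [Fintype α] [DecidableEq α] {r : ℕ} (hr : 1 ≤ r)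
    (hs : ∀ T : SetSupport (uniformOnBases M), T.1.card = r)
    (τ : SetSupport (uniformOnBases M)) (t : ℕ) :
    (∑ σ, |(downUpWalk (uniformOnBases M) ^ t) τ σ - uniformOnBases M σ.1|) ^ 2 ≤
      Fintype.card (SetSupport (uniformOnBases M)) * ((1 - 1 / (r : ℝ)) ^ t) ^ 2 := by
  let Ω := SetSupport (uniformOnBases M)
  let s : Ω → Finset α := Subtype.val
  have hr0 : (0 : ℝ) < r := by exact_mod_cast hr
  have hK : (0 : ℝ) < Fintype.card Ω := by
    have : 0 < Fintype.card Ω := Fintype.card_pos_iff.2 ⟨τ⟩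
    exact_mod_cast this
  have hB : ∀ X : Finset α, M.IsBase (X : Set α) ↔ ∃ T, s T = X := by
    intro X
    rw [← uniformOnBases_ne_zero_iff]
    exact ⟨fun h => ⟨⟨X, h⟩, rfl⟩, fun ⟨T, hT⟩ => hT ▸ T.2⟩
  -- Given `U`, the walk passes through it with probability `1 / r` from any basis above it and then
  -- picks uniformly among `upCount s U` bases.
  let c : Finset α → ℝ := fun U => if U.card + 1 = r then 1 / (r * upCount s U) else 0
  let a : Finset α → Ω → ℝ := fun U T => if U ⊆ s T then 1 else 0
  have hc : ∀ U, 0 ≤ c U := by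
    intro U
    have := upCount_nonneg s U
    simp only [c]
    split_ifs <;> positivity
  have hP : ∀ τ σ, downUpWalk (uniformOnBases M) τ σ = ∑ U, c U * a U τ * a U σ := by
    intro τ σ
    have hne : τ.1 ≠ ∅ := by
      rw [← card_pos.trans nonempty_iff_ne_empty |>.eq]
      rw [hs]; exact hr
    have hden : ∀ U : Finset α, ∑ ρ : Ω, (if U ⊆ ρ.1 then uniformOnBases M ρ.1 else 0) =
        1 / (Fintype.card Ω : ℝ) * upCount s U := by
      intro U
      rw [upCount, upSum, mul_sum]
      refine sum_congr rfl fun ρ _ => ?_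
      rw [uniformOnBases_apply]
      simp only [mul_ite, mul_one, mul_zero, s, Ω]
    unfold downUpWalk
    rw [if_neg hne]
    rw [sum_erase_eq (hs τ) fun U => 1 / (τ.1.card : ℝ) * (if U ⊆ σ.1 then
        uniformOnBases M σ.1 / ∑ ρ : Ω, (if U ⊆ ρ.1 then uniformOnBases M ρ.1 else 0) else 0)]
    refine sum_congr rfl fun U _ => ?_
    rw [hden, uniformOnBases_apply, hs]
    have h1 : 1 / (Fintype.card Ω : ℝ) / (1 / (Fintype.card Ω : ℝ) * upCount s U) =
        1 / upCount s U := by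
      rw [← div_div, div_self (by positivity)]
    rw [h1]
    simp only [c, a, s]
    by_cases h2 : U.card + 1 = r <;> by_cases h3 : U ⊆ τ.1 <;> by_cases h4 : U ⊆ σ.1 <;>
      simp [h2, h3, h4]
    ring
  have hsum : ∀ (U : Finset α) (f : Ω → ℝ), ∑ T, a U T * f T = upSum s U f := by
    intro U f
    exact sum_congr rfl fun T _ => by simp only [a, ite_mul, one_mul, zero_mul]
  have hcount : ∀ T : Ω, ∑ U : Finset α, (if U.card + 1 = r ∧ U ⊆ s T then (1 : ℝ) else 0) = r := by
    intro T
    rw [← sum_erase_eq (hs T) fun _ => 1]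
    simp [hs]
  have hrow : ∀ τ, ∑ σ, downUpWalk (uniformOnBases M) τ σ = 1 := by
    intro τ
    simp only [hP]
    rw [sum_comm]
    have h1 : ∀ U, ∑ σ, c U * a U τ * a U σ =
        1 / r * if U.card + 1 = r ∧ U ⊆ s τ then (1 : ℝ) else 0 := by
      intro U
      have h2 : ∑ σ, a U σ = upCount s U := by
        rw [upCount, ← hsum]; simp
      rw [← mul_sum, h2]
      by_cases h3 : U.card + 1 = r <;> by_cases h4 : U ⊆ s τ <;> simp [c, a, h3, h4]
      have h5 : upCount s U ≠ 0 := by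
        intro h6
        have := upSum_eq_zero h6 fun σ => if σ = τ then 1 else 0
        rw [upSum, sum_eq_single τ (fun σ _ h => by simp [h]) (by simp)] at this
        simp [h4] at this
      field_simp
    rw [sum_congr rfl fun U _ => h1 U, ← mul_sum, hcount]
    field_simp
  -- For `x` of sum zero the global variance is `‖x‖²`, and the local ones add up to `r ‖x‖² - r
  -- Q(x)`, since each basis has `r` subsets `U`. The Poincaré inequality rearranges to the bound.
  have hl : ∀ x : Ω → ℝ, ∑ τ, x τ = 0 →
      ∑ U, c U * (∑ τ, a U τ * x τ) ^ 2 ≤ (1 - 1 / (r : ℝ)) * ∑ τ, x τ ^ 2 := by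
    intro x hx
    have h1 := upVar_empty_le_sum hB Subtype.val_injective hr hs x
    have h2 : upVar s ∅ x = ∑ τ, x τ ^ 2 := by
      simp [upVar, upSum, hx]
    have h3 : ∑ U : Finset α, (if U.card + 1 = r then upVar s U x else 0) =
        r * ∑ τ, x τ ^ 2 - r * ∑ U, c U * (∑ τ, a U τ * x τ) ^ 2 := by
      have h4 : r * ∑ τ, x τ ^ 2 =
          ∑ U : Finset α, if U.card + 1 = r then upSum s U (fun τ => x τ ^ 2) else 0 := by
        have h5 : ∀ U : Finset α, (if U.card + 1 = r then upSum s U (fun τ => x τ ^ 2) else 0) =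
            ∑ τ, (if U.card + 1 = r ∧ U ⊆ s τ then 1 else 0) * x τ ^ 2 := by
          intro U
          by_cases h : U.card + 1 = r <;> simp [h, upSum]
        rw [sum_congr rfl fun U _ => h5 U, sum_comm, mul_sum]
        exact sum_congr rfl fun τ _ => by rw [← sum_mul, hcount]
      rw [h4, mul_sum, ← sum_sub_distrib]
      refine sum_congr rfl fun U _ => ?_
      rw [hsum]
      by_cases h : U.card + 1 = r
      · simp only [h, if_true, c, upVar]
        field_simp
      · simp [h, c]
    rw [h2, h3] at h1
    refine le_of_mul_le_mul_left ?_ hr0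
    have h6 : (r : ℝ) * ((1 - 1 / (r : ℝ)) * ∑ τ, x τ ^ 2) =
        r * ∑ τ, x τ ^ 2 - ∑ τ, x τ ^ 2 := by
      field_simp
    rw [h6]
    linarith
  have := sq_sum_abs_pow_sub_le hc hP hrow hl τ t
  simp only [uniformOnBases_apply]
  exact this

end Walk

/-! ### The mixing time bound. -/

theorem mainTheorem10 (n r : ℕ) (M : Matroid (Fin n)) (hE : M.E = Set.univ)
    (hr : M.eRank = (r : ℕ∞)) (B : Finset (Fin n)) (hB : M.IsBase (B : Set (Fin n)))
    (ε : ℝ) (hε0 : 0 < ε) (hε1 : ε < 1)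
    (hex : ¬ (n = 2 ∧ r = 1 ∧ (∀ i : Fin n, M.Indep {i}) ∧ 2 / Real.exp 1 < ε)) :
    (∃ t : ℕ,
      IsMixingTime (downUpWalk (uniformOnBases M)) (fun σ => uniformOnBases M σ.1)
        ⟨B, uniformOnBases_ne_zero hB⟩ ε t ∧
      (t : ℝ) ≤ r * Real.log ((n : ℝ) ^ r / ε)) ∧
    (r : ℝ) * Real.log ((n : ℝ) ^ r / ε) ≤ (r : ℝ) ^ 2 * Real.log ((n : ℝ) / ε) := by
  have hcard : ∀ X : Finset (Fin n), M.IsBase (X : Set (Fin n)) → X.card = r := by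
    intro X hX
    have h1 := hX.encard_eq_eRank
    rw [hr, Set.encard_coe_eq_coe_finsetCard] at h1
    exact_mod_cast h1
  have hs : ∀ T : SetSupport (uniformOnBases M), T.1.card = r := fun T =>
    hcard _ ((uniformOnBases_ne_zero_iff T.1).1 T.2)
  have hrn : r ≤ n := by
    rw [← hcard B hB]
    simpa using Finset.card_le_univ B
  have hpow1 : (1 : ℝ) ≤ (n : ℝ) ^ r := by
    rcases Nat.eq_zero_or_pos r with rfl | h
    · simp
    · have : (1 : ℝ) ≤ n := by exact_mod_cast h.trans_le hrn
      exact one_le_pow₀ this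
  have hlog : Real.log ((n : ℝ) ^ r / ε) = r * Real.log n - Real.log ε := by
    rw [Real.log_div (by positivity) hε0.ne', Real.log_pow]
  have hlogε : Real.log ε ≤ 0 := Real.log_nonpos hε0.le hε1.le
  refine ⟨?_, ?_⟩
  swap
  · rcases Nat.eq_zero_or_pos r with rfl | h
    · simp
    · have hr1 : (1 : ℝ) ≤ r := by exact_mod_cast h
      have hn : (0 : ℝ) < n := by exact_mod_cast h.trans_le hrn
      rw [hlog, Real.log_div hn.ne' hε0.ne']
      -- The two bounds differ by `r (r - 1) (-log ε) ≥ 0`.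
      nlinarith [mul_nonneg (mul_nonneg (sub_nonneg.2 hr1) (by linarith : (0 : ℝ) ≤ r))
        (neg_nonneg.2 hlogε)]
  suffices h : ∃ t : ℕ, ∑ σ, |(downUpWalk (uniformOnBases M) ^ t)
      ⟨B, uniformOnBases_ne_zero hB⟩ σ - uniformOnBases M σ.1| ≤ ε ∧
      (t : ℝ) ≤ r * Real.log ((n : ℝ) ^ r / ε) by
    classical
    obtain ⟨t, ht, htb⟩ := h
    have hne : ∃ t : ℕ, ∑ σ, |(downUpWalk (uniformOnBases M) ^ t)
      ⟨B, uniformOnBases_ne_zero hB⟩ σ - uniformOnBases M σ.1| ≤ ε := ⟨t, ht⟩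
    refine ⟨Nat.find hne, ⟨Nat.find_spec hne, fun u hu => Nat.find_min' hne hu⟩, ?_⟩
    exact le_trans (by exact_mod_cast Nat.find_min' hne ht) htb
  set τ : SetSupport (uniformOnBases M) := ⟨B, uniformOnBases_ne_zero hB⟩
  have hKc : Fintype.card (SetSupport (uniformOnBases M)) ≤ n.choose r := by
    rw [Fintype.card_subtype]
    refine (Finset.card_le_card (t := Finset.powersetCard r Finset.univ) fun X hX => ?_).trans_eq
      (by rw [Finset.card_powersetCard, Finset.card_univ, Fintype.card_fin])
    simp only [Finset.mem_filter, Finset.mem_univ, true_and] at hX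
    exact Finset.mem_powersetCard.2
      ⟨Finset.subset_univ X, hcard X ((uniformOnBases_ne_zero_iff X).1 hX)⟩
  have hKpos : 0 < Fintype.card (SetSupport (uniformOnBases M)) := Fintype.card_pos_iff.2 ⟨τ⟩
  rcases Nat.lt_or_ge 1 (Fintype.card (SetSupport (uniformOnBases M))) with hK | hK
  swap
  · have hK1 : Fintype.card (SetSupport (uniformOnBases M)) = 1 := by omega
    have hsub : ∀ σ, σ = τ := fun σ => Fintype.card_le_one_iff.1 hK σ τ
    refine ⟨0, ?_, ?_⟩
    · refine le_trans (le_of_eq (Finset.sum_eq_zero fun σ _ => ?_)) hε0.le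
      rw [uniformOnBases_apply, hK1, hsub σ]
      simp
    · have : 0 ≤ Real.log ((n : ℝ) ^ r / ε) :=
        Real.log_nonneg ((one_le_div hε0).2 (hε1.le.trans hpow1))
      simp only [Nat.cast_zero]
      positivity
  have hr1 : 1 ≤ r := by
    by_contra h
    have : r = 0 := by omega
    rw [this, Nat.choose_zero_right] at hKc
    omega
  have hn2 : 2 ≤ n := by
    by_contra h
    have h1 : n = 1 := by omega
    have h2 : r = 1 := by omega
    rw [show n.choose r = 1 by rw [h1, h2, Nat.choose_self]] at hKc
    omega
  have hmix := sq_sum_abs_downUpWalk_pow_sub_le hr1 hs τ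
  -- In rank one the factor `1 - 1 / r` is zero and one step mixes exactly, so only `1 ≤ log (n /
  -- ε)` is at stake. It holds for `n ≥ 3 > e`; for `n = 2` two bases force both elements to be
  -- non-loops, and the excluded case leaves `ε ≤ 2 / e`.
  rcases hr1.eq_or_lt with h1 | h2
  · subst h1
    refine ⟨1, ?_, ?_⟩
    · have := hmix 1
      simp only [Nat.cast_one, div_one, sub_self, pow_one, ne_eq, OfNat.ofNat_ne_zero,
        not_false_eq_true, zero_pow, mul_zero] at this ⊢
      exact (pow_eq_zero_iff two_ne_zero |>.1 (le_antisymm this (sq_nonneg _))).le.trans hε0.le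
    · have hexp : Real.exp 1 ≤ n / ε := by
        rw [le_div_iff₀ hε0]
        rcases hn2.eq_or_lt with h3 | h3
        · subst h3
          have hall : ∀ i : Fin 2, M.Indep {i} := by
            have heq : (Finset.univ.filter fun X : Finset (Fin 2) => uniformOnBases M X ≠ 0) =
                Finset.powersetCard 1 Finset.univ := by
              refine Finset.eq_of_subset_of_card_le (fun X hX => ?_) ?_
              · simp only [Finset.mem_filter, Finset.mem_univ, true_and] at hX
                exact Finset.mem_powersetCard.2
                  ⟨Finset.subset_univ X, hcard X ((uniformOnBases_ne_zero_iff X).1 hX)⟩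
              · rw [← Fintype.card_subtype, Finset.card_powersetCard, Finset.card_univ,
                  Fintype.card_fin, Nat.choose_one_right]
                exact hK
            intro i
            have hi : ({i} : Finset (Fin 2)) ∈ Finset.powersetCard 1 Finset.univ := by simp
            rw [← heq] at hi
            simp only [Finset.mem_filter, Finset.mem_univ, true_and] at hi
            have := ((uniformOnBases_ne_zero_iff _).1 hi).indep
            simpa using this
          have h4 : ε ≤ 2 / Real.exp 1 := by
            by_contra h4
            exact hex ⟨rfl, rfl, hall, not_le.1 h4⟩
          rw [le_div_iff₀ (Real.exp_pos 1)] at h4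
          push_cast
          linarith
        · have h4 : (3 : ℝ) ≤ n := by exact_mod_cast h3
          have h5 := Real.exp_one_lt_d9
          have h6 := Real.exp_pos 1
          nlinarith
      have := (Real.le_log_iff_exp_le (by positivity)).2 hexp
      simpa using this
  · have hrR : (2 : ℝ) ≤ r := by exact_mod_cast h2
    set T : ℝ := r * Real.log ((n : ℝ) ^ r / ε) with hT
    have hT0 : 0 ≤ T := by
      have : 0 ≤ Real.log ((n : ℝ) ^ r / ε) :=
        Real.log_nonneg ((one_le_div hε0).2 (hε1.le.trans hpow1))
      positivity
    refine ⟨⌊T⌋₊, ?_, Nat.floor_le hT0⟩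
    refine abs_le_of_sq_le_sq' ((hmix _).trans ?_) hε0.le |>.2
    have hlt := Nat.lt_floor_add_one T
    set t := ⌊T⌋₊
    have hb0 : (0 : ℝ) ≤ 1 - 1 / (r : ℝ) := by
      rw [sub_nonneg, div_le_one (by linarith)]; linarith
    -- Rounding `T` down costs at most `exp (1 / r) ≤ exp (1 / 2)`.
    have h3 : (1 - 1 / (r : ℝ)) ^ t ≤ Real.exp (1 / 2) * (ε / (n : ℝ) ^ r) := by
      calc (1 - 1 / (r : ℝ)) ^ t ≤ Real.exp (-(1 / (r : ℝ))) ^ t :=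
            pow_le_pow_left₀ hb0 (Real.one_sub_le_exp_neg _) t
        _ = Real.exp (-(t / r)) := by rw [← Real.exp_nat_mul]; congr 1; ring
        _ ≤ Real.exp (1 / 2 - Real.log ((n : ℝ) ^ r / ε)) := by
            apply Real.exp_le_exp.2
            have h4 : Real.log ((n : ℝ) ^ r / ε) = T / r := by rw [hT]; field_simp
            have h5 : T / r ≤ t / r + 1 / r := by
              rw [← add_div]; exact div_le_div_of_nonneg_right hlt.le (by linarith)
            have h6 : 1 / (r : ℝ) ≤ 1 / 2 := one_div_le_one_div_of_le (by norm_num) hrR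
            rw [h4]; linarith
        _ = _ := by
            rw [Real.exp_sub, Real.exp_log (by positivity)]
            field_simp
    have h4 : ((1 - 1 / (r : ℝ)) ^ t) ^ 2 ≤ Real.exp 1 * (ε / (n : ℝ) ^ r) ^ 2 := by
      calc _ ≤ (Real.exp (1 / 2) * (ε / (n : ℝ) ^ r)) ^ 2 :=
            pow_le_pow_left₀ (pow_nonneg hb0 t) h3 2
        _ = _ := by
            rw [mul_pow, ← Real.exp_nat_mul]; norm_num
    have hKn : (Fintype.card (SetSupport (uniformOnBases M)) : ℝ) ≤ (n : ℝ) ^ r := by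
      exact_mod_cast hKc.trans (Nat.choose_le_pow n r)
    -- The rounding loss, squared, is `e < 4`. It is absorbed because the prefactor is only `√N ≤
    -- n^(r/2)` while `T` provides for `n^r`.
    have hn4 : (4 : ℝ) ≤ (n : ℝ) ^ r := by
      have : (2 : ℝ) ≤ n := by exact_mod_cast hn2
      calc (4 : ℝ) = 2 ^ 2 := by norm_num
        _ ≤ (n : ℝ) ^ 2 := pow_le_pow_left₀ (by norm_num) this 2
        _ ≤ (n : ℝ) ^ r := pow_le_pow_right₀ (by linarith) h2
    have h5 := Real.exp_one_lt_d9
    calc _ ≤ (n : ℝ) ^ r * (4 * (ε / (n : ℝ) ^ r) ^ 2) := by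
          refine mul_le_mul hKn (h4.trans ?_) (sq_nonneg _) (by positivity)
          exact mul_le_mul_of_nonneg_right (by linarith) (sq_nonneg _)
      _ = 4 / (n : ℝ) ^ r * ε ^ 2 := by field_simp
      _ ≤ 1 * ε ^ 2 := by
          refine mul_le_mul_of_nonneg_right ?_ (sq_nonneg _)
          rw [div_le_one (by linarith)]; exact hn4
      _ = ε ^ 2 := one_mul _
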